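/- For a finite connected graph $G$, let $H(G)=\sum_{\{u,v\}}\frac{1}{d(u,v)}$ be its Harary index, where the sum runs over all unordered pairs of distinct vertices and $d(u,v)$ is the distance in $G$; let the radius of $G$ be the minimum, over all vertices $v$, of the maximum distance from $v$ to a vertex of $G$. For integers $d\ge 2$, $1\le i\le d-1$ and $n\ge d+1$, let $C_{n,d,i}$ be the caterpillar on $n$ vertices obtained from a path $v_0v_1\cdots v_d$ by attaching $n-d-1$ pendent vertices to $v_i$. Let $T$ be a tree on $n$ vertices with radius $r\ge 2$, and put $d=2r-1$. Then $$H(T)\le H\bigl(C_{n,\,2r-1,\,\lfloor d/2\rfloor}\bigr),$$ with equality if and only if $T\cong C_{n,\,2r-1,\,\lfloor d/2\rfloor}$. (Here $\lfloor d/2\rfloor=r-1$, and $n\ge 2r$ holds for every tree of radius $r$.) -/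

import Mathlib

namespace HararyIndex

open Classical in
/-- The reciprocal distance matrix (Harary matrix) of a graph: the entry at `(u, v)` is
`1 / d(u, v)` for distinct vertices `u`, `v`, and the diagonal is zero. -/
noncomputable def reciprocalDistMatrix {V : Type*} (G : SimpleGraph V) : Matrix V V ℝ :=
  Matrix.of fun u v => if u = v then 0 else 1 / (G.dist u v : ℝ)

/-- The Harary index: the half-sum of the entries of the reciprocal distance matrix, that is, the
sum of `1 / d(u, v)` over all unordered pairs of distinct vertices. -/
noncomputable def harary {V : Type*} [Fintype V] (G : SimpleGraph V) : ℝ :=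
  (1 / 2) * ∑ u, ∑ v, reciprocalDistMatrix G u v

/-- The caterpillar `C_{n,d,i}` on the `n` vertices `0, …, n - 1`, for `1 ≤ i ≤ d - 1` and
`d + 1 ≤ n`: the vertices `0, …, d` form the path `v_0 v_1 … v_d`, and each of the remaining
`n - d - 1` vertices `d + 1, …, n - 1` is pendent, attached to `v_i`. -/
def caterpillar (n d i : ℕ) : SimpleGraph (Fin n) :=
  SimpleGraph.fromRel fun u v : Fin n =>
    (v.val = u.val + 1 ∧ v.val ≤ d) ∨ (u.val = i ∧ d < v.val)

end HararyIndex

/-! A tree of radius `r` contains a geodesic `p` of length `2 * r - 1`, and a vertex off `p` has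
distances `t + |j - k|` to the `p j` (`exists_dist_geodesic`). Pairs on `p` contribute a constant to
the index. A pair off `p` contributes at most 1/2, or 1 if adjacent; the surplus 1/2 of an edge is
charged to its endpoint farther from `p 0`, so no vertex is charged twice. A charged vertex has `t ≥
2`, which costs it more than 1/2 in its sum over `p` (`sum_inv_add_half_lt_pendentSum`). Hence the
best choice is `t = 1` with `k` central (`pendentSum_le`), and `harary_le_caterpillarHarary`
follows.

Equality forces the vertices off `p` to hang on `p (r - 1)` or `p r` at mutual distance two, hence
all on the same one; reversing `p` exchanges the two. For the caterpillar only the inequality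
`caterpillarHarary ≤ harary` is proved: the sandwich supplies the rest. -/

namespace HararyIndex

open SimpleGraph

variable {V : Type*} {G T : SimpleGraph V}

/-! ### Geodesics and distances in trees. -/

/-- The vertices `p 0, …, p d` form a geodesic of length `d`. -/
def IsGeodesic (G : SimpleGraph V) (d : ℕ) (p : ℕ → V) : Prop :=
  ∀ i ≤ d, ∀ j ≤ d, G.dist (p i) (p j) = ((j : ℤ) - i).natAbs

theorem IsGeodesic.injOn {d : ℕ} {p : ℕ → V} (hp : IsGeodesic G d p) {i j : ℕ}
    (hi : i ≤ d) (hj : j ≤ d) (h : p i = p j) : i = j := by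
  have := hp i hi j hj
  rw [h, dist_self] at this
  omega

theorem IsGeodesic.reverse {d : ℕ} {p : ℕ → V} (hp : IsGeodesic G d p) :
    IsGeodesic G d fun j => p (d - j) := by
  intro i hi j hj
  have := hp (d - i) (by omega) (d - j) (by omega)
  simp only [this]
  omega

theorem IsGeodesic.adj_iff {d : ℕ} {p : ℕ → V} (hp : IsGeodesic G d p) {i j : ℕ}
    (hi : i ≤ d) (hj : j ≤ d) : G.Adj (p i) (p j) ↔ j = i + 1 ∨ i = j + 1 := by
  rw [← dist_eq_one_iff_adj, hp i hi j hj]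
  omega

theorem exists_walk_of_adj_succ {d : ℕ} {p : ℕ → V} (h : ∀ j < d, G.Adj (p j) (p (j + 1)))
    (i k : ℕ) (hik : i + k ≤ d) : ∃ w : G.Walk (p i) (p (i + k)), w.length = k := by
  induction k with
  | zero => exact ⟨Walk.nil, rfl⟩
  | succ k ih =>
    obtain ⟨w, hw⟩ := ih (by omega)
    exact ⟨w.concat (h (i + k) (by omega)), by simp [hw]⟩

theorem dist_le_of_adj_succ {d : ℕ} {p : ℕ → V} (h : ∀ j < d, G.Adj (p j) (p (j + 1)))
    {i j : ℕ} (hi : i ≤ d) (hj : j ≤ d) : G.dist (p i) (p j) ≤ ((j : ℤ) - i).natAbs := by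
  have key : ∀ a b : ℕ, a ≤ b → b ≤ d → G.dist (p a) (p b) ≤ b - a := by
    intro a b hab hb
    obtain ⟨w, hw⟩ := exists_walk_of_adj_succ h a (b - a) (by omega)
    have := dist_le w
    rwa [hw, Nat.add_sub_cancel' hab] at this
  rcases le_total i j with hij | hij
  · have := key i j hij hj
    omega
  · have := key j i hij hi
    rw [dist_comm]
    omega

theorem isGeodesic_of_adj_succ (hG : G.Connected) {d : ℕ} {p : ℕ → V}
    (h : ∀ j < d, G.Adj (p j) (p (j + 1))) (hd : d ≤ G.dist (p 0) (p d)) :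
    IsGeodesic G d p := by
  have key : ∀ a b : ℕ, a ≤ b → b ≤ d → G.dist (p a) (p b) = b - a := by
    intro a b hab hb
    have h1 := dist_le_of_adj_succ h (Nat.zero_le d) (hab.trans hb)
    have h2 := dist_le_of_adj_succ h (hab.trans hb) hb
    have h3 := dist_le_of_adj_succ h hb le_rfl
    have h4 := hG.dist_triangle (u := p 0) (v := p a) (w := p d)
    have h5 := hG.dist_triangle (u := p a) (v := p b) (w := p d)
    omega
  intro i hi j hj
  rcases le_total i j with hij | hij
  · rw [key i j hij hj]
    omega
  · rw [dist_comm, key j i hij hi]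
    omega

theorem exists_isGeodesic (hG : G.Connected) (u v : V) :
    ∃ p : ℕ → V, p 0 = u ∧ p (G.dist u v) = v ∧ IsGeodesic G (G.dist u v) p := by
  obtain ⟨w, hw⟩ := hG.exists_walk_length_eq_dist u v
  refine ⟨w.getVert, w.getVert_zero, hw ▸ w.getVert_length, ?_⟩
  apply isGeodesic_of_adj_succ hG
  · intro j hj
    exact w.adj_getVert_succ (hw ▸ hj)
  · rw [← hw, w.getVert_zero, w.getVert_length, hw]

/-- In a tree, every vertex has at most one neighbour closer to a given vertex. -/
theorem closer_neighbor_unique (hT : T.IsTree) {x v a b : V} (ha : T.Adj a v) (hb : T.Adj b v)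
    (hda : T.dist x v = T.dist x a + 1) (hdb : T.dist x v = T.dist x b + 1) : a = b := by
  obtain ⟨wa, hwa⟩ := hT.connected.exists_walk_length_eq_dist x a
  obtain ⟨wb, hwb⟩ := hT.connected.exists_walk_length_eq_dist x b
  have h1 : (wa.concat ha).IsPath := Walk.isPath_of_length_eq_dist _ (by simp [hwa, hda])
  have h2 : (wb.concat hb).IsPath := Walk.isPath_of_length_eq_dist _ (by simp [hwb, hdb])
  exact (Walk.concat_inj ((hT.existsUnique_path x v).unique h1 h2)).1

/-- The distances from a vertex of a tree to the vertices of a geodesic. -/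
theorem exists_dist_geodesic (hT : T.IsTree) {d : ℕ} {p : ℕ → V} (hp : IsGeodesic T d p)
    (x : V) : ∃ k ≤ d, ∃ t, ∀ j ≤ d, T.dist x (p j) = t + ((j : ℤ) - k).natAbs := by
  obtain ⟨k, hk, hmin⟩ := Finset.exists_min_image (Finset.range (d + 1))
    (fun j => T.dist x (p j)) ⟨0, by simp⟩
  simp only [Finset.mem_range, Nat.lt_succ_iff] at hk hmin
  have hadj : ∀ j, j + 1 ≤ d → T.Adj (p j) (p (j + 1)) := fun j hj =>
    (hp.adj_iff (by omega) hj).2 (Or.inl rfl)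
  have hstep : ∀ j, j + 1 ≤ d → T.dist x (p j) = T.dist x (p (j + 1)) + 1 ∨
      T.dist x (p (j + 1)) = T.dist x (p j) + 1 := fun j hj =>
    hT.dist_eq_dist_add_one_of_adj x (hadj j hj)
  -- A local maximum at `p (j + 1)` would give it two distinct neighbours closer to `x`. So once the
  -- distance increases away from the minimum at `k`, it keeps increasing.
  have hpeak : ∀ j, j + 2 ≤ d → T.dist x (p (j + 1)) = T.dist x (p j) + 1 →
      T.dist x (p (j + 1)) = T.dist x (p (j + 2)) + 1 → False := by
    intro j hj h1 h2
    have := closer_neighbor_unique hT (hadj j (by omega)) (hadj (j + 1) hj).symm h1 h2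
    have := hp.injOn (by omega) hj this
    omega
  have hup : ∀ m, k + m ≤ d → T.dist x (p (k + m)) = T.dist x (p k) + m := by
    intro m
    induction m using Nat.strong_induction_on with
    | _ m ih =>
      intro hm
      match m, ih, hm with
      | 0, _, _ => simp
      | 1, _, hm =>
        have := hmin (k + 1) hm
        have := hstep k hm
        omega
      | m + 2, ih, hm =>
        have h1 := ih m (by omega) (by omega)
        have h2 := ih (m + 1) (by omega) (by omega)
        have h3 := hpeak (k + m) (by omega)
        have h4 := hstep (k + m + 1) (by omega)
        have e1 : k + (m + 1) = k + m + 1 := by omega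
        have e2 : k + (m + 2) = k + m + 2 := by omega
        rw [e1] at h2
        rw [e2]
        by_contra hne
        exact h3 (by omega) (by
          rcases h4 with h4 | h4
          · exact h4
          · exact absurd (by rw [h4, h2]; omega) hne)
  have hdown : ∀ m, m ≤ k → T.dist x (p (k - m)) = T.dist x (p k) + m := by
    intro m
    induction m using Nat.strong_induction_on with
    | _ m ih =>
      intro hm
      match m, ih, hm with
      | 0, _, _ => simp
      | 1, _, hm =>
        have h1 := hmin (k - 1) (by omega)
        have h2 := hstep (k - 1) (by omega)
        rw [Nat.sub_add_cancel hm] at h2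
        omega
      | m + 2, ih, hm =>
        have h1 := ih m (by omega) (by omega)
        have h2 := ih (m + 1) (by omega) (by omega)
        obtain ⟨l, rfl⟩ : ∃ l, k = l + (m + 2) := ⟨k - (m + 2), by omega⟩
        have e1 : l + (m + 2) - m = l + 2 := by omega
        have e2 : l + (m + 2) - (m + 1) = l + 1 := by omega
        have e3 : l + (m + 2) - (m + 2) = l := by omega
        rw [e1] at h1
        rw [e2] at h2
        rw [e3]
        have h3 := hpeak l (by omega)
        have h4 := hstep l (by omega)
        rcases h4 with h4 | h4
        · omega
        · exact (h3 h4 (by rw [h2, h1]; omega)).elim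
  refine ⟨k, hk, T.dist x (p k), fun j hj => ?_⟩
  rcases le_total k j with hkj | hkj
  · have := hup (j - k) (by omega)
    rw [Nat.add_sub_cancel' hkj] at this
    omega
  · have := hdown (k - j) (by omega)
    rw [Nat.sub_sub_self hkj] at this
    omega

/-- A finite tree of radius at least `r` contains a geodesic of length `2 * r - 1`. -/
theorem exists_isGeodesic_of_le_radius [Finite V] (hT : T.IsTree) {r : ℕ} (hr : 1 ≤ r)
    (hrad : (r : ℕ∞) ≤ T.radius) : ∃ p : ℕ → V, IsGeodesic T (2 * r - 1) p := by
  have := hT.connected.nonempty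
  obtain ⟨⟨u, v⟩, hmax⟩ := Finite.exists_max fun q : V × V => T.dist q.1 q.2
  obtain ⟨p, h0, hD, hp⟩ := exists_isGeodesic hT.connected u v
  generalize hDd : T.dist u v = D at hp hD hmax
  by_cases hDr : 2 * r - 1 ≤ D
  · exact ⟨p, fun i hi j hj => hp i (hi.trans hDr) j (hj.trans hDr)⟩
  exfalso
  -- Maximality of `D` gives `t ≤ min k (D - k)`, so the midpoint is within `⌈D / 2⌉ ≤ r - 1` of
  -- `x`.
  have hle : ∀ x, T.dist (p (D / 2)) x ≤ r - 1 := by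
    intro x
    obtain ⟨k, hk, t, h⟩ := exists_dist_geodesic hT hp x
    have h1 := hmax (x, p 0)
    have h2 := hmax (x, p D)
    simp only at h1 h2
    rw [h 0 (by omega)] at h1
    rw [h D le_rfl] at h2
    rw [dist_comm, h (D / 2) (by omega)]
    omega
  have hecc : T.eccent (p (D / 2)) ≤ ((r - 1 : ℕ) : ℕ∞) := by
    rw [eccent_le_iff]
    intro x
    rw [← (hT.connected _ x).coe_dist_eq_edist]
    exact_mod_cast hle x
  have := hrad.trans (radius_le_eccent.trans hecc)
  have : r ≤ r - 1 := by exact_mod_cast this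
  omega

/-! ### The Harary index, split along a path. -/

theorem harary_eq_sum_inv_dist [Fintype V] (G : SimpleGraph V) :
    harary G = (1 / 2) * ∑ u, ∑ v, (G.dist u v : ℝ)⁻¹ := by
  unfold harary reciprocalDistMatrix
  congr 1
  refine Finset.sum_congr rfl fun u _ => Finset.sum_congr rfl fun v _ => ?_
  rw [Matrix.of_apply]
  split_ifs with h
  · simp [h]
  · simp

theorem dist_iso_le {W : Type*} {H : SimpleGraph W} (hG : G.Connected) (e : G ≃g H) (u v : V) :
    H.dist (e u) (e v) ≤ G.dist u v := by
  obtain ⟨w, hw⟩ := hG.exists_walk_length_eq_dist u v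
  have := dist_le (w.map e.toHom)
  rwa [Walk.length_map, hw] at this

theorem harary_eq_of_iso [Fintype V] {W : Type*} [Fintype W] {H : SimpleGraph W}
    (hG : G.Connected) (e : G ≃g H) : harary G = harary H := by
  rw [harary_eq_sum_inv_dist, harary_eq_sum_inv_dist]
  congr 1
  refine Fintype.sum_equiv e.toEquiv _ _ fun u => Fintype.sum_equiv e.toEquiv _ _ fun v => ?_
  have hH : H.Connected := e.connected_iff.1 hG
  have h1 := dist_iso_le hG e u v
  have h2 := dist_iso_le hH e.symm (e u) (e v)
  rw [e.symm_apply_apply, e.symm_apply_apply] at h2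
  rw [le_antisymm h2 h1]
  rfl

open Classical in
/-- The vertices other than `p 0, …, p d`. -/
noncomputable def offPath [Fintype V] (d : ℕ) (p : ℕ → V) : Finset V :=
  ((Finset.range (d + 1)).image p)ᶜ

theorem mem_offPath [Fintype V] {d : ℕ} {p : ℕ → V} {w : V} :
    w ∈ offPath d p ↔ ∀ j ≤ d, p j ≠ w := by
  simp [offPath]

theorem card_offPath [Fintype V] {d : ℕ} {p : ℕ → V}
    (hp : ∀ i ≤ d, ∀ j ≤ d, p i = p j → i = j) :
    (offPath d p).card + (d + 1) = Fintype.card V := by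
  classical
  have h : ((Finset.range (d + 1)).image p).card = d + 1 := by
    rw [Finset.card_image_of_injOn, Finset.card_range]
    intro i hi j hj
    simp only [Finset.coe_range, Set.mem_Iio, Nat.lt_succ_iff] at hi hj
    exact hp i hi j hj
  have := Finset.card_add_card_compl ((Finset.range (d + 1)).image p)
  rw [h] at this
  rw [← this, add_comm]
  congr!

theorem sum_eq_sum_path_add_sum_offPath [Fintype V] {d : ℕ} {p : ℕ → V}
    (hp : ∀ i ≤ d, ∀ j ≤ d, p i = p j → i = j) (f : V → ℝ) :
    ∑ u, f u = ∑ j ∈ Finset.range (d + 1), f (p j) + ∑ w ∈ offPath d p, f w := by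
  classical
  rw [← Finset.sum_add_sum_compl ((Finset.range (d + 1)).image p), Finset.sum_image]
  · congr!
  · intro i hi j hj
    simp only [Finset.coe_range, Set.mem_Iio, Nat.lt_succ_iff] at hi hj
    exact hp i hi j hj

theorem sum_sum_eq_of_symm [Fintype V] {d : ℕ} {p : ℕ → V}
    (hp : ∀ i ≤ d, ∀ j ≤ d, p i = p j → i = j) (f : V → V → ℝ) (hf : ∀ u v, f u v = f v u) :
    ∑ u, ∑ v, f u v =
      ∑ i ∈ Finset.range (d + 1), ∑ j ∈ Finset.range (d + 1), f (p i) (p j) +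
      ∑ w ∈ offPath d p, (2 * ∑ j ∈ Finset.range (d + 1), f w (p j) +
        ∑ x ∈ offPath d p, f w x) := by
  rw [sum_eq_sum_path_add_sum_offPath hp]
  simp only [sum_eq_sum_path_add_sum_offPath hp (f _), Finset.sum_add_distrib, ← Finset.mul_sum]
  rw [Finset.sum_comm (s := Finset.range (d + 1)) (t := offPath d p)]
  have : ∑ w ∈ offPath d p, ∑ i ∈ Finset.range (d + 1), f (p i) w =
      ∑ w ∈ offPath d p, ∑ i ∈ Finset.range (d + 1), f w (p i) :=
    Finset.sum_congr rfl fun w _ => Finset.sum_congr rfl fun i _ => hf _ _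
  rw [this]
  ring

/-! ### Where a pendent vertex is best attached. -/

/-- The sum of the reciprocals of the distances from a pendent vertex attached to `v_k` to the
vertices of the path `v_0, …, v_d`. -/
noncomputable def pendentSum (d k : ℕ) : ℝ :=
  ∑ j ∈ Finset.range (d + 1), (1 + (((j : ℤ) - k).natAbs : ℝ))⁻¹

/-- Moving the attachment point one step shifts the summands: one term enters at the `v_0` end and
one leaves at the `v_d` end. -/
theorem pendentSum_succ {d k : ℕ} (hk : k ≤ d) :
    pendentSum d (k + 1) = pendentSum d k + ((k + 2 : ℝ)⁻¹ - (d + 1 - k : ℝ)⁻¹) := by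
  unfold pendentSum
  rw [Finset.sum_range_succ', Finset.sum_range_succ]
  have h1 : (((0 : ℕ) : ℤ) - (k + 1 : ℕ)).natAbs = k + 1 := by omega
  have h2 : ((d : ℤ) - k).natAbs = d - k := by omega
  have h3 : ∀ j : ℕ, (((j + 1 : ℕ) : ℤ) - (k + 1 : ℕ)).natAbs = ((j : ℤ) - k).natAbs := by
    intro j; omega
  simp only [h1, h2, h3]
  rw [Nat.cast_sub hk]
  push_cast
  have e1 : (1 + ((k : ℝ) + 1)) = k + 2 := by ring
  have e2 : (1 + ((d : ℝ) - k)) = d + 1 - k := by ring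
  rw [e1, e2]
  ring

theorem pendentSum_sub {d k : ℕ} (hk : k ≤ d) : pendentSum d (d - k) = pendentSum d k := by
  unfold pendentSum
  rw [← Finset.sum_range_reflect]
  refine Finset.sum_congr rfl fun j hj => ?_
  rw [Finset.mem_range] at hj
  have : (((d + 1 - 1 - j : ℕ) : ℤ) - (d - k : ℕ)).natAbs = ((j : ℤ) - k).natAbs := by omega
  rw [this]

theorem pendentSum_lt_of_lt {r k : ℕ} (hk : k < r - 1) :
    pendentSum (2 * r - 1) k < pendentSum (2 * r - 1) (r - 1) := by
  have hstep : ∀ m, m + 1 < r → pendentSum (2 * r - 1) m < pendentSum (2 * r - 1) (m + 1) := by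
    intro m hm
    rw [pendentSum_succ (by omega)]
    have hcast : ((2 * r - 1 : ℕ) : ℝ) + 1 = 2 * r := by
      rw [Nat.cast_sub (by omega)]; push_cast; ring
    rw [hcast]
    have h1 : (m : ℝ) + 1 + 1 ≤ r := by exact_mod_cast hm
    have : (2 * r - m : ℝ)⁻¹ < (m + 2 : ℝ)⁻¹ :=
      inv_strictAnti₀ (by positivity) (by linarith)
    linarith
  have key : ∀ m, k + 1 + m < r →
      pendentSum (2 * r - 1) k < pendentSum (2 * r - 1) (k + 1 + m) := by
    intro m
    induction m with
    | zero => exact fun h => hstep k h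
    | succ m ih => exact fun h => (ih (by omega)).trans (hstep _ h)
  have := key (r - 1 - (k + 1)) (by omega)
  rwa [Nat.add_sub_cancel' (by omega)] at this

theorem pendentSum_lt {r k : ℕ} (hk : k ≤ 2 * r - 1) (h1 : k ≠ r - 1) (h2 : k ≠ r) :
    pendentSum (2 * r - 1) k < pendentSum (2 * r - 1) (r - 1) := by
  rcases lt_or_ge k (r - 1) with h | h
  · exact pendentSum_lt_of_lt h
  · rw [← pendentSum_sub hk]
    exact pendentSum_lt_of_lt (by omega)

theorem pendentSum_le {r k : ℕ} (hk : k ≤ 2 * r - 1) :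
    pendentSum (2 * r - 1) k ≤ pendentSum (2 * r - 1) (r - 1) := by
  by_cases h1 : k = r - 1
  · rw [h1]
  by_cases h2 : k = r
  · subst h2
    rw [← pendentSum_sub hk]
    apply le_of_eq
    congr 1
    omega
  exact (pendentSum_lt hk h1 h2).le

/-! ### Lower bound from upper bounds on distances. -/

/-- The Harary index of the caterpillar with `m` pendent vertices attached to `v_c`. -/
noncomputable def caterpillarHarary (d c m : ℕ) : ℝ :=
  (1 / 2) * (∑ i ∈ Finset.range (d + 1), ∑ j ∈ Finset.range (d + 1),
      (((j : ℤ) - i).natAbs : ℝ)⁻¹ + m * (2 * pendentSum d c + (m - 1) / 2))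

theorem caterpillarHarary_le_harary [Fintype V] (hG : G.Connected) {d c : ℕ} {p : ℕ → V}
    (hp : ∀ i ≤ d, ∀ j ≤ d, p i = p j → i = j)
    (hpp : ∀ i ≤ d, ∀ j ≤ d, G.dist (p i) (p j) ≤ ((j : ℤ) - i).natAbs)
    (hop : ∀ w ∈ offPath d p, ∀ j ≤ d, G.dist w (p j) ≤ 1 + ((j : ℤ) - c).natAbs)
    (hoo : ∀ w ∈ offPath d p, ∀ x ∈ offPath d p, G.dist w x ≤ 2) :
    caterpillarHarary d c (offPath d p).card ≤ harary G := by
  have hinv : ∀ {u v : V} {k : ℕ}, u ≠ v → G.dist u v ≤ k → (k : ℝ)⁻¹ ≤ (G.dist u v : ℝ)⁻¹ := by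
    intro u v k huv hk
    have := hG.pos_dist_of_ne huv
    exact inv_anti₀ (by exact_mod_cast this) (by exact_mod_cast hk)
  classical
  rw [harary_eq_sum_inv_dist, caterpillarHarary,
    sum_sum_eq_of_symm hp _ fun u v => by rw [dist_comm]]
  gcongr ?_ * (?_ + ?_)
  · gcongr ∑ i ∈ _, ∑ j ∈ _, ?_ with i hi j hj
    rw [Finset.mem_range, Nat.lt_succ_iff] at hi hj
    by_cases hij : i = j
    · simp [hij]
    · exact hinv (fun h => hij (hp i hi j hj h)) (hpp i hi j hj)
  · rw [← nsmul_eq_mul]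
    refine Finset.card_nsmul_le_sum _ _ _ fun w hw => ?_
    gcongr ?_ * ?_ + ?_
    · unfold pendentSum
      gcongr ∑ j ∈ _, ?_ with j hj
      rw [Finset.mem_range, Nat.lt_succ_iff] at hj
      have := hinv (mem_offPath.1 hw j hj).symm (hop w hw j hj)
      push_cast at this ⊢
      exact this
    · have h1 : ((offPath d p).card - 1 : ℝ) / 2
          = ∑ x ∈ (offPath d p).erase w, (2 : ℝ)⁻¹ := by
        rw [Finset.sum_const, nsmul_eq_mul, Finset.card_erase_of_mem hw,
          Nat.cast_sub (Finset.card_pos.2 ⟨w, hw⟩), Nat.cast_one]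
        ring
      rw [h1, ← Finset.add_sum_erase _ _ hw, dist_self]
      simp only [Nat.cast_zero, inv_zero, zero_add]
      gcongr ∑ x ∈ _, ?_ with x hx
      have := hinv (k := 2) (Finset.ne_of_mem_erase hx).symm
        (hoo w hw x (Finset.mem_of_mem_erase hx))
      exact_mod_cast this

/-! ### Upper bound for trees, by charging edges off the geodesic. -/

open Classical in
/-- The indicator of `x` being the neighbour of `w` on the way to `o`. -/
noncomputable def isParent (G : SimpleGraph V) (o w x : V) : ℝ :=
  if G.Adj x w ∧ G.dist o w = G.dist o x + 1 then 1 else 0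

theorem isParent_nonneg (o w x : V) : 0 ≤ isParent G o w x := by
  unfold isParent
  split_ifs <;> norm_num

theorem sum_isParent_le_one (hT : T.IsTree) (o w : V) (s : Finset V) :
    ∑ x ∈ s, isParent T o w x ≤ 1 := by
  classical
  unfold isParent
  rw [Finset.sum_boole]
  have : (s.filter fun x => T.Adj x w ∧ T.dist o w = T.dist o x + 1).card ≤ 1 := by
    rw [Finset.card_le_one]
    intro a ha b hb
    rw [Finset.mem_filter] at ha hb
    exact closer_neighbor_unique hT ha.2.1 hb.2.1 ha.2.2 hb.2.2
  exact_mod_cast this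

/-- The unique neighbour of `w` closer to `p 0` is `p k`, which lies on the geodesic. -/
theorem isParent_eq_zero_of_pendent [Fintype V] (hT : T.IsTree) {d k : ℕ} {p : ℕ → V}
    (hp : IsGeodesic T d p) (hk : k ≤ d) {w x : V}
    (hw : ∀ j ≤ d, T.dist w (p j) = 1 + ((j : ℤ) - k).natAbs) (hx : x ∈ offPath d p) :
    isParent T (p 0) w x = 0 := by
  refine if_neg fun h => ?_
  have h0 := hw 0 (by omega)
  have hkk := hw k hk
  have h1 : T.Adj (p k) w := by
    rw [← dist_eq_one_iff_adj, dist_comm, hkk]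
    omega
  have h2 := hp 0 (by omega) k hk
  rw [dist_comm] at h0
  exact mem_offPath.1 hx k hk (closer_neighbor_unique hT h1 h.1 (by omega) h.2)

theorem inv_dist_le (hT : T.IsTree) (o : V) {w x : V} (h : w ≠ x) :
    (T.dist w x : ℝ)⁻¹ ≤ 1 / 2 + (isParent T o w x + isParent T o x w) / 2 := by
  have hpos := hT.connected.pos_dist_of_ne h
  by_cases hadj : T.Adj w x
  · rw [dist_eq_one_iff_adj.2 hadj]
    rcases hT.dist_eq_dist_add_one_of_adj o hadj with h1 | h1
    · have h2 : isParent T o w x = 1 := if_pos ⟨hadj.symm, h1⟩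
      have := isParent_nonneg (G := T) o x w
      rw [h2]; norm_num; linarith
    · have h2 : isParent T o x w = 1 := if_pos ⟨hadj, h1⟩
      have := isParent_nonneg (G := T) o w x
      rw [h2]; norm_num; linarith
  · have h2 : 2 ≤ T.dist w x := by
      have := mt dist_eq_one_iff_adj.1 hadj
      omega
    have h3 : (T.dist w x : ℝ)⁻¹ ≤ (2 : ℝ)⁻¹ :=
      inv_anti₀ (by norm_num) (by exact_mod_cast h2)
    have := isParent_nonneg (G := T) o x w
    have := isParent_nonneg (G := T) o w x
    linarith

/-- The term `j = k` alone loses at least 1/2; since `d ≥ 1` there is another term, and it loses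
strictly. -/
theorem sum_inv_add_half_lt_pendentSum {d k t : ℕ} (hd : 1 ≤ d) (hk : k ≤ d) (ht : 2 ≤ t) :
    ∑ j ∈ Finset.range (d + 1), (t + (((j : ℤ) - k).natAbs : ℝ))⁻¹ + 1 / 2 < pendentSum d k := by
  have hmem : k ∈ Finset.range (d + 1) := by simpa [Nat.lt_succ_iff] using hk
  unfold pendentSum
  rw [← Finset.add_sum_erase _ _ hmem, ← Finset.add_sum_erase _ _ hmem]
  have ht' : (2 : ℝ) ≤ t := by exact_mod_cast ht
  have h1 : (t : ℝ)⁻¹ ≤ (2 : ℝ)⁻¹ := inv_anti₀ (by norm_num) ht'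
  have h2 : ∑ j ∈ (Finset.range (d + 1)).erase k, (t + (((j : ℤ) - k).natAbs : ℝ))⁻¹ <
      ∑ j ∈ (Finset.range (d + 1)).erase k, (1 + (((j : ℤ) - k).natAbs : ℝ))⁻¹ := by
    refine Finset.sum_lt_sum_of_nonempty ?_ fun j _ => ?_
    · rw [← Finset.card_pos, Finset.card_erase_of_mem hmem, Finset.card_range]
      omega
    · exact inv_strictAnti₀ (by positivity) (by linarith)
  simp only [sub_self, Int.natAbs_zero, Nat.cast_zero, add_zero]
  linarith

/-- The contribution of a vertex off the geodesic, with the equality case. -/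
theorem offPath_contribution [Fintype V] (hT : T.IsTree) {r : ℕ} (hr : 1 ≤ r) {p : ℕ → V}
    (hp : IsGeodesic T (2 * r - 1) p) {w : V} (hw : w ∈ offPath (2 * r - 1) p) :
    2 * ∑ j ∈ Finset.range (2 * r - 1 + 1), (T.dist w (p j) : ℝ)⁻¹ +
        ∑ x ∈ offPath (2 * r - 1) p, isParent T (p 0) w x ≤
      2 * pendentSum (2 * r - 1) (r - 1) ∧
    (2 * ∑ j ∈ Finset.range (2 * r - 1 + 1), (T.dist w (p j) : ℝ)⁻¹ +
        ∑ x ∈ offPath (2 * r - 1) p, isParent T (p 0) w x =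
      2 * pendentSum (2 * r - 1) (r - 1) →
      ∃ k, (k = r - 1 ∨ k = r) ∧
        ∀ j ≤ 2 * r - 1, T.dist w (p j) = 1 + ((j : ℤ) - k).natAbs) := by
  obtain ⟨k, hk, t, h⟩ := exists_dist_geodesic hT hp w
  have hsum : ∑ j ∈ Finset.range (2 * r - 1 + 1), (T.dist w (p j) : ℝ)⁻¹ =
      ∑ j ∈ Finset.range (2 * r - 1 + 1), (t + (((j : ℤ) - k).natAbs : ℝ))⁻¹ := by
    refine Finset.sum_congr rfl fun j hj => ?_
    rw [Finset.mem_range, Nat.lt_succ_iff] at hj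
    rw [h j hj]
    push_cast
    rfl
  have hle := pendentSum_le hk
  have ht0 : t ≠ 0 := by
    intro ht
    have h0 := h k hk
    rw [ht, sub_self, Int.natAbs_zero, hT.connected.dist_eq_zero_iff] at h0
    exact mem_offPath.1 hw k hk h0.symm
  by_cases ht1 : t = 1
  · subst ht1
    have hpar : ∑ x ∈ offPath (2 * r - 1) p, isParent T (p 0) w x = 0 :=
      Finset.sum_eq_zero fun x hx => isParent_eq_zero_of_pendent hT hp hk h hx
    rw [hpar, hsum, Nat.cast_one]
    change 2 * pendentSum _ k + 0 ≤ _ ∧ (2 * pendentSum _ k + 0 = _ → _)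
    refine ⟨by linarith, fun heq => ⟨k, ?_, h⟩⟩
    by_contra! hne
    have := pendentSum_lt hk hne.1 hne.2
    linarith
  · have h1 := sum_inv_add_half_lt_pendentSum (d := 2 * r - 1) (k := k) (t := t)
      (by omega) hk (by omega)
    have h2 := sum_isParent_le_one hT (p 0) w (offPath (2 * r - 1) p)
    rw [hsum]
    exact ⟨by linarith, fun heq => by linarith⟩

open Classical in
theorem sum_sum_pair_bound (o : V) (s : Finset V) :
    ∑ w ∈ s, ∑ x ∈ s, (if w = x then 0
      else 1 / 2 + (isParent T o w x + isParent T o x w) / 2) =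
    s.card * ((s.card - 1) / 2 : ℝ) + ∑ w ∈ s, ∑ x ∈ s, isParent T o w x := by
  have hself : ∀ w, isParent T o w w = 0 := fun w => if_neg fun h => T.loopless.irrefl w h.1
  have h1 : ∀ w ∈ s, ∀ x ∈ s, (if w = x then (0 : ℝ)
      else 1 / 2 + (isParent T o w x + isParent T o x w) / 2) =
      (1 / 2 - if w = x then 1 / 2 else 0) +
        (isParent T o w x / 2 + isParent T o x w / 2) := by
    intro w _ x _
    split_ifs with h
    · simp [h, hself]
    · ring
  rw [Finset.sum_congr rfl fun w hw => Finset.sum_congr rfl (h1 w hw)]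
  simp only [Finset.sum_add_distrib, Finset.sum_sub_distrib]
  rw [Finset.sum_comm (f := fun w x => isParent T o x w / 2)]
  simp only [Finset.sum_const, nsmul_eq_mul, Finset.sum_ite_eq, ← Finset.sum_div]
  rw [Finset.sum_congr (g := fun _ => (1 / 2 : ℝ)) rfl fun w hw => if_pos hw]
  simp only [Finset.sum_const, nsmul_eq_mul]
  ring

/-- The upper bound on the Harary index of a tree with a geodesic of length `2 * r - 1`, and the
structure of the trees attaining it. -/
theorem harary_le_caterpillarHarary [Fintype V] (hT : T.IsTree) {r : ℕ} (hr : 1 ≤ r) {p : ℕ → V}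
    (hp : IsGeodesic T (2 * r - 1) p) :
    harary T ≤ caterpillarHarary (2 * r - 1) (r - 1) (offPath (2 * r - 1) p).card ∧
    (harary T = caterpillarHarary (2 * r - 1) (r - 1) (offPath (2 * r - 1) p).card →
      (∀ w ∈ offPath (2 * r - 1) p, ∃ k, (k = r - 1 ∨ k = r) ∧
        ∀ j ≤ 2 * r - 1, T.dist w (p j) = 1 + ((j : ℤ) - k).natAbs) ∧
      ∀ w ∈ offPath (2 * r - 1) p, ∀ x ∈ offPath (2 * r - 1) p, w ≠ x → T.dist w x = 2) := by
  classical
  set O := offPath (2 * r - 1) p with hO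
  have hpath : ∑ i ∈ Finset.range (2 * r - 1 + 1), ∑ j ∈ Finset.range (2 * r - 1 + 1),
      (T.dist (p i) (p j) : ℝ)⁻¹ = ∑ i ∈ Finset.range (2 * r - 1 + 1),
      ∑ j ∈ Finset.range (2 * r - 1 + 1), (((j : ℤ) - i).natAbs : ℝ)⁻¹ := by
    refine Finset.sum_congr rfl fun i hi => Finset.sum_congr rfl fun j hj => ?_
    rw [Finset.mem_range, Nat.lt_succ_iff] at hi hj
    rw [hp i hi j hj]
  have hH := sum_sum_eq_of_symm (d := 2 * r - 1) (p := p)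
    (fun i hi j hj => hp.injOn hi hj) (fun u v => (T.dist u v : ℝ)⁻¹)
    (fun u v => by rw [dist_comm])
  rw [← hO, hpath, Finset.sum_add_distrib] at hH
  have hpair : ∀ w ∈ O, ∀ x ∈ O, (T.dist w x : ℝ)⁻¹ ≤ if w = x then 0
      else 1 / 2 + (isParent T (p 0) w x + isParent T (p 0) x w) / 2 := by
    intro w _ x _
    split_ifs with h
    · simp [h]
    · exact inv_dist_le hT (p 0) h
  have hinner := fun w hw => Finset.sum_le_sum (hpair w hw)
  have h1 := Finset.sum_le_sum hinner
  have hcontr := fun w (hw : w ∈ O) => (offPath_contribution hT hr hp hw).1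
  have h2 := Finset.sum_le_sum hcontr
  have h1' := h1
  rw [sum_sum_pair_bound] at h1'
  have h2' := h2
  rw [Finset.sum_add_distrib, Finset.sum_const, nsmul_eq_mul] at h2'
  rw [harary_eq_sum_inv_dist, hH, caterpillarHarary]
  refine ⟨by linarith, fun heq => ?_⟩
  -- Equality of the totals makes both summed bounds tight, hence tight term by term.
  have e2 : ∀ w ∈ O, _ := (Finset.sum_eq_sum_iff_of_le hcontr).1
    (le_antisymm h2 (by rw [Finset.sum_add_distrib, Finset.sum_const, nsmul_eq_mul]; linarith))
  have e1 : ∀ w ∈ O, _ := (Finset.sum_eq_sum_iff_of_le hinner).1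
    (le_antisymm h1 (by rw [sum_sum_pair_bound]; linarith))
  have hpend := fun w (hw : w ∈ O) => (offPath_contribution hT hr hp hw).2 (e2 w hw)
  refine ⟨hpend, fun w hw x hx hwx => ?_⟩
  have e := (Finset.sum_eq_sum_iff_of_le (hpair w hw)).1 (e1 w hw) x hx
  obtain ⟨k, hk, hkd⟩ := hpend w hw
  obtain ⟨l, hl, hld⟩ := hpend x hx
  rw [if_neg hwx, isParent_eq_zero_of_pendent hT hp (by omega) hkd hx,
    isParent_eq_zero_of_pendent hT hp (by omega) hld hw] at e
  have e' : (T.dist w x : ℝ)⁻¹ = (2 : ℝ)⁻¹ := by rw [e]; norm_num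
  exact_mod_cast inv_injective e'

/-! ### Structure in the equality case. -/

/-- Two pendent vertices at distance two hang on the same vertex of the geodesic. -/
theorem pendent_eq_of_dist_eq_two (hT : T.IsTree) {d : ℕ} {p : ℕ → V}
    {w x : V} {k l : ℕ} (hk : k ≤ d) (hl : l ≤ d)
    (hw : ∀ j ≤ d, T.dist w (p j) = 1 + ((j : ℤ) - k).natAbs)
    (hx : ∀ j ≤ d, T.dist x (p j) = 1 + ((j : ℤ) - l).natAbs) (hp : IsGeodesic T d p)
    (hwx : T.dist w x = 2) : k = l := by
  wlog hkl : k ≤ l generalizing k l w x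
  · exact (this hl hk hx hw (by rwa [dist_comm]) (by omega)).symm
  by_contra hne
  obtain ⟨q, hq0, hq2, hq⟩ := exists_isGeodesic hT.connected w x
  rw [hwx] at hq hq2
  have a1 : T.Adj w (q 1) := by rw [← hq0, hq.adj_iff (by omega) (by omega)]; omega
  have a2 : T.Adj (q 1) x := by rw [← hq2, hq.adj_iff (by omega) (by omega)]; omega
  have a3 : T.Adj (p l) x := by
    rw [← dist_eq_one_iff_adj, dist_comm, hx l hl]; omega
  have hx0 := hx 0 (by omega)
  have hw0 := hw 0 (by omega)
  rw [dist_comm] at hx0 hw0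
  have d1 := hT.dist_eq_dist_add_one_of_adj (p 0) a1
  have d2 := hT.dist_eq_dist_add_one_of_adj (p 0) a2
  have d3 := hp 0 (by omega) l hl
  -- From `p 0`, `q 1` is at distance `k` or `k + 2`, and also `l` or `l + 2`. As `k < l`, this
  -- distance is `l`, so `q 1` and `p l` are both closer neighbours of `x`.
  have := closer_neighbor_unique hT a2 a3 (x := p 0) (by omega) (by omega)
  rw [this, ← dist_eq_one_iff_adj, hw l hl] at a1
  omega

theorem caterpillar_adj_iff {n d i : ℕ} {u v : Fin n} :
    (caterpillar n d i).Adj u v ↔ u ≠ v ∧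
      (((v.val = u.val + 1 ∧ v.val ≤ d) ∨ (u.val = i ∧ d < v.val)) ∨
        ((u.val = v.val + 1 ∧ u.val ≤ d) ∨ (v.val = i ∧ d < u.val))) :=
  fromRel_adj _ _ _

theorem nonempty_iso_caterpillar [Fintype V] {d c : ℕ} (hc : c ≤ d) {p : ℕ → V}
    (hp : IsGeodesic T d p)
    (hop : ∀ w ∈ offPath d p, ∀ j ≤ d, T.dist w (p j) = 1 + ((j : ℤ) - c).natAbs)
    (hoo : ∀ w ∈ offPath d p, ∀ x ∈ offPath d p, w ≠ x → T.dist w x = 2) :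
    Nonempty (T ≃g caterpillar (Fintype.card V) d c) := by
  have hcard := card_offPath (d := d) (p := p) (fun i hi j hj => hp.injOn hi hj)
  let e := (offPath d p).equivFin
  have hlt : ∀ a : Fin (Fintype.card V), ¬ a.val ≤ d → a.val - (d + 1) < (offPath d p).card := by
    intro a ha
    have := a.isLt
    omega
  let g : Fin (Fintype.card V) → V := fun a =>
    if h : a.val ≤ d then p a.val else e.symm ⟨a.val - (d + 1), hlt a h⟩
  have hg1 : ∀ a : Fin (Fintype.card V), a.val ≤ d → g a = p a.val := fun a h => dif_pos h
  have hg2 : ∀ a : Fin (Fintype.card V), ¬ a.val ≤ d → g a ∈ offPath d p := by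
    intro a h
    simp only [g, dif_neg h]
    exact (e.symm _).2
  have hinj : Function.Injective g := by
    intro a b hab
    by_cases ha : a.val ≤ d <;> by_cases hb : b.val ≤ d
    · rw [hg1 a ha, hg1 b hb] at hab
      exact Fin.ext (hp.injOn ha hb hab)
    · rw [hg1 a ha] at hab
      exact (mem_offPath.1 (hg2 b hb) _ ha hab).elim
    · rw [hg1 b hb] at hab
      exact (mem_offPath.1 (hg2 a ha) _ hb hab.symm).elim
    · simp only [g, dif_neg ha, dif_neg hb] at hab
      have := e.symm.injective (Subtype.ext hab)
      rw [Fin.mk.injEq] at this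
      exact Fin.ext (by omega)
  have hbij : Function.Bijective g :=
    (Fintype.bijective_iff_injective_and_card g).2 ⟨hinj, by simp⟩
  refine ⟨Iso.symm ⟨Equiv.ofBijective g hbij, ?_⟩⟩
  intro a b
  rw [Equiv.ofBijective_apply, Equiv.ofBijective_apply, caterpillar_adj_iff, ne_eq, Fin.ext_iff]
  by_cases ha : a.val ≤ d <;> by_cases hb : b.val ≤ d
  · rw [hg1 a ha, hg1 b hb, hp.adj_iff ha hb]
    omega
  · rw [hg1 a ha, adj_comm, ← dist_eq_one_iff_adj, hop _ (hg2 b hb) _ ha]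
    omega
  · rw [hg1 b hb, ← dist_eq_one_iff_adj, hop _ (hg2 a ha) _ hb]
    omega
  · rw [← dist_eq_one_iff_adj]
    by_cases hab : a = b
    · simp [hab]
    · rw [hoo _ (hg2 a ha) _ (hg2 b hb) (fun h => hab (hinj h))]
      omega

/-- Walks along the spine and through `v_c` bound all distances from above, so no exact distance is
computed. -/
theorem caterpillarHarary_le_harary_caterpillar {n d c : ℕ} (hc : c ≤ d) (hn : d + 1 ≤ n) :
    caterpillarHarary d c (n - (d + 1)) ≤ harary (caterpillar n d c) := by
  set G := caterpillar n d c with hGdef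
  let p : ℕ → Fin n := fun j => if h : j < n then ⟨j, h⟩ else ⟨0, by omega⟩
  have hpv : ∀ j ≤ d, (p j).val = j := by
    intro j hj
    simp only [p, dif_pos (show j < n by omega)]
  have hinj : ∀ i ≤ d, ∀ j ≤ d, p i = p j → i = j := by
    intro i hi j hj h
    rw [← hpv i hi, ← hpv j hj, h]
  have hadj : ∀ j < d, G.Adj (p j) (p (j + 1)) := by
    intro j hj
    rw [hGdef, caterpillar_adj_iff, ne_eq, Fin.ext_iff, hpv j hj.le, hpv (j + 1) hj]
    omega
  have hoff : ∀ w ∈ offPath d p, G.Adj w (p c) := by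
    intro w hw
    have hwd : d < w.val := by
      by_contra! h
      exact mem_offPath.1 hw _ h (Fin.ext (hpv _ h))
    rw [hGdef, caterpillar_adj_iff, ne_eq, Fin.ext_iff, hpv c hc]
    omega
  have hreach : ∀ j ≤ d, G.Reachable (p 0) (p j) := by
    intro j hj
    obtain ⟨w, -⟩ := exists_walk_of_adj_succ hadj 0 j (by omega)
    rw [Nat.zero_add] at w
    exact ⟨w⟩
  have hconn : G.Connected := by
    rw [connected_iff_exists_forall_reachable]
    refine ⟨p 0, fun w => ?_⟩
    by_cases hw : w ∈ offPath d p
    · exact (hreach c hc).trans (hoff w hw).symm.reachable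
    · rw [mem_offPath] at hw
      push Not at hw
      obtain ⟨j, hj, rfl⟩ := hw
      exact hreach j hj
  have hcard := card_offPath hinj
  rw [Fintype.card_fin] at hcard
  rw [show n - (d + 1) = (offPath d p).card by omega]
  refine caterpillarHarary_le_harary hconn hinj
    (fun i hi j hj => dist_le_of_adj_succ hadj hi hj) ?_ ?_
  · intro w hw j hj
    have h1 := dist_eq_one_iff_adj.2 (hoff w hw)
    have h2 := dist_le_of_adj_succ hadj hc hj
    have h3 := hconn.dist_triangle (u := w) (v := p c) (w := p j)
    omega
  · intro w hw x hx
    have h1 := dist_eq_one_iff_adj.2 (hoff w hw)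
    have h2 := dist_eq_one_iff_adj.2 (hoff x hx).symm
    have h3 := hconn.dist_triangle (u := w) (v := p c) (w := x)
    omega

theorem nonempty_iso_caterpillar_of_harary_eq [Fintype V] (hT : T.IsTree) {r : ℕ} (hr : 1 ≤ r)
    {p : ℕ → V} (hp : IsGeodesic T (2 * r - 1) p)
    (heq : harary T = caterpillarHarary (2 * r - 1) (r - 1) (offPath (2 * r - 1) p).card) :
    Nonempty (T ≃g caterpillar (Fintype.card V) (2 * r - 1) (r - 1)) := by
  obtain ⟨hpend, hoo⟩ := (harary_le_caterpillarHarary hT hr hp).2 heq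
  by_cases hall : ∀ w ∈ offPath (2 * r - 1) p, ∀ j ≤ 2 * r - 1,
      T.dist w (p j) = 1 + ((j : ℤ) - (r - 1 : ℕ)).natAbs
  · exact nonempty_iso_caterpillar (by omega) hp hall hoo
  push Not at hall
  obtain ⟨w, hw, i, hi, hwi⟩ := hall
  obtain ⟨k, hk, hkd⟩ := hpend w hw
  have hkr : k = r := by
    rcases hk with rfl | hk
    · exact (hwi (hkd i hi)).elim
    · exact hk
  subst hkr
  have hall : ∀ x ∈ offPath (2 * k - 1) p, ∀ j ≤ 2 * k - 1,
      T.dist x (p j) = 1 + ((j : ℤ) - k).natAbs := by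
    intro x hx
    by_cases hwx : w = x
    · exact hwx ▸ hkd
    obtain ⟨l, hl, hld⟩ := hpend x hx
    have := pendent_eq_of_dist_eq_two hT (by omega) (by omega) hkd hld hp (hoo w hw x hx hwx)
    exact this ▸ hld
  have hrev : ∀ x, x ∈ offPath (2 * k - 1) (fun j => p (2 * k - 1 - j)) →
      x ∈ offPath (2 * k - 1) p := by
    intro x hx
    rw [mem_offPath] at hx ⊢
    intro j hj h
    refine hx (2 * k - 1 - j) (by omega) ?_
    rwa [Nat.sub_sub_self hj]
  -- Reversal sends index `k` to `2 * k - 1 - k = k - 1`, the required attachment point.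
  refine nonempty_iso_caterpillar (by omega) hp.reverse (fun x hx j hj => ?_)
    fun x hx y hy => hoo x (hrev x hx) y (hrev y hy)
  rw [hall x (hrev x hx) _ (by omega)]
  omega

end HararyIndex

theorem corollary3p8 {V : Type*} [Fintype V] (T : SimpleGraph V) (hT : T.IsTree)
    (n : ℕ) (hn : Fintype.card V = n) (r : ℕ) (hr : 2 ≤ r) (hrad : T.radius = (r : ℕ∞)) :
    HararyIndex.harary T
        ≤ HararyIndex.harary (HararyIndex.caterpillar n (2 * r - 1) ((2 * r - 1) / 2)) ∧
      (HararyIndex.harary T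
          = HararyIndex.harary (HararyIndex.caterpillar n (2 * r - 1) ((2 * r - 1) / 2)) ↔
        Nonempty (T ≃g HararyIndex.caterpillar n (2 * r - 1) ((2 * r - 1) / 2))) := by
  subst hn
  obtain ⟨p, hp⟩ := HararyIndex.exists_isGeodesic_of_le_radius hT (by omega) hrad.ge
  have hcard := HararyIndex.card_offPath (d := 2 * r - 1) (p := p) (fun i hi j hj => hp.injOn hi hj)
  rw [show (2 * r - 1) / 2 = r - 1 by omega]
  have h1 := (HararyIndex.harary_le_caterpillarHarary hT (by omega) hp).1
  have h2 := HararyIndex.caterpillarHarary_le_harary_caterpillar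
    (n := Fintype.card V) (d := 2 * r - 1) (c := r - 1) (by omega) (by omega)
  rw [show Fintype.card V - (2 * r - 1 + 1) = (HararyIndex.offPath (2 * r - 1) p).card by
    omega] at h2
  refine ⟨h1.trans h2, fun heq => ?_, fun ⟨e⟩ => HararyIndex.harary_eq_of_iso hT.connected e⟩
  exact HararyIndex.nonempty_iso_caterpillar_of_harary_eq hT (by omega) hp
    (le_antisymm h1 (heq ▸ h2))
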